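/- All operads are one-coloured, unital, symmetric operads in topological spaces. Call two such operads *homotopy equivalent* if they are connected by a finite zigzag of morphisms of topological symmetric operads, each of which is a homotopy equivalence of spaces in every arity. For $X\subseteq\mathbb R^n$ let $\mathrm{Rect}(X,X)$ be the set of maps $f:X\to X$ of the form $f(x)=rx+b$ with $r>0$, $b\in\mathbb R^n$, with the compact-open topology; it is a topological monoid under composition for the sets $X$ used below. A symmetric relation $\perp$ on $\mathrm{Rect}(X,X)$ which is stable under composition on both sides defines an operad $\mathcal P$ with $$\mathcal P(k)=\{(f_1,\dots,f_k)\in \mathrm{Rect}(X,X)^k : f_i\perp f_j \text{ for } i\ne j\},$$ with the subspace topology, unit $\mathrm{id}_X$, composition $(f_i)\circ\big((g_{i\ell})_\ell\big)_i=(f_i\circ g_{i\ell})_{i,\ell}$, and symmetric groups acting by permuting the entries. Let $\mathbb R^{1,n-1}$ be $\mathbb R^n$ with the Minkowski form $\eta(v,v)=-v_0^2+v_1^2+\dots+v_{n-1}^2$, time oriented by $(1,0,\dots,0)$. A nonzero vector $v$ is causal if $\eta(v,v)\le 0$ and timelike if $\eta(v,v)<0$. A differentiable curve is causal if its tangent vectors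 are all causal; $I^{+}(p)$ (resp. $I^-(p)$) is the set of points reached from $p$ (resp. from which $p$ is reached) by a differentiable curve with future-directed timelike tangent vectors. Subsets $S,T$ are causally disjoint if $S\cap T=\emptyset$ and no causal curve joins a point of $S$ and a point of $T$. Let $D^n$ be the closed Euclidean unit disc and $\Diamond^n=I^-(1,0,\dots,0)\cap I^+(-1,0,\dots,0)$ the standard open causal diamond. Define the following operads as above: * $\mathcal P_{\mathsf{CD}_n}$: $X=D^n$, with $f\perp g$ iff $f(D^n)$ and $g(D^n)$ are causally disjoint in $\mathbb R^{1,n-1}$; * $\mathcal P_{\mathsf{CDiam}_n}$: $X=\Diamond^n$, with $f\perp g$ iff $f(\Diamond^n)$ and $g(\Diamond^n)$ are causally disjoint in $\mathbb R^{1,n-1}$; * $\mathcal P_{\mathsf{Disc}_{m}}$: $X=D^{m}$, with $f\perp g$ iff the interiors of $f(D^m)$ and $g(D^m)$ are disjoint. **Proposition.** For every $n\ge 2$, the operads $\mathcal P_{\mathsf{CD}_n}$, $\mathcal P_{\mathsf{CDiam}_n}$ and $\mathcal P_{\mathsf{Disc}_{n-1}}$ are pairwise homotopy equivalent. -/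

import Mathlib

open Set Topology

noncomputable section

namespace CausalOperad

/-! ## Topological symmetric operads -/

/-- A (one-coloured, unital, symmetric) operad in topological spaces.

`relabel` is the symmetric group action, with the bookkeeping of arities built in: a bijection
`Fin k ≃ Fin l` exists only for `k = l`, and relabelling along it is the (left) action of a
permutation, up to the identification `k = l`. Inputs of a composite are ordered
lexicographically, by the bijection `finSigmaFinEquiv : (Σ i, Fin (j i)) ≃ Fin (∑ i, j i)`. -/
structure TopOperad where
  /-- the space of operations of arity `k` -/
  space : ℕ → Type
  /-- its topology -/
  top : ∀ k, TopologicalSpace (space k)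
  /-- the identity operation -/
  unit : space 1
  /-- operadic composition -/
  comp : ∀ {k : ℕ} {j : Fin k → ℕ}, space k → (∀ i, space (j i)) → space (∑ i, j i)
  /-- symmetric group action -/
  relabel : ∀ {k l : ℕ}, (Fin k ≃ Fin l) → space k → space l
  continuous_comp : ∀ {k : ℕ} (j : Fin k → ℕ),
    Continuous (fun p : space k × (∀ i, space (j i)) => comp p.1 p.2)
  continuous_relabel : ∀ {k l : ℕ} (e : Fin k ≃ Fin l), Continuous (relabel e)
  relabel_refl : ∀ {k : ℕ} (f : space k), relabel (Equiv.refl (Fin k)) f = f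
  relabel_trans : ∀ {k l m : ℕ} (e : Fin k ≃ Fin l) (e' : Fin l ≃ Fin m) (f : space k),
    relabel (e.trans e') f = relabel e' (relabel e f)
  comp_unit : ∀ {k : ℕ} (f : space k),
    relabel ((finSigmaFinEquiv (n := fun _ : Fin k => 1)).symm.trans
      (Equiv.sigmaUnique (Fin k) (fun _ => Fin 1))) (comp f (fun _ => unit)) = f
  unit_comp : ∀ {k : ℕ} (f : space k),
    relabel ((finSigmaFinEquiv (n := fun _ : Fin 1 => k)).symm.trans
      (Equiv.uniqueSigma (fun _ : Fin 1 => Fin k))) (comp unit (fun _ => f)) = f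
  comp_assoc : ∀ {k : ℕ} {j : Fin k → ℕ} {m : ∀ i, Fin (j i) → ℕ}
    (f : space k) (g : ∀ i, space (j i)) (h : ∀ i l, space (m i l)),
    relabel
      (finSigmaFinEquiv.symm.trans <|
        (Equiv.sigmaCongrLeft (β := fun y : (Σ i, Fin (j i)) => Fin (m y.1 y.2))
          finSigmaFinEquiv.symm).trans <|
        (Equiv.sigmaAssoc (fun i l => Fin (m i l))).trans <|
        (Equiv.sigmaCongrRight (fun _ => finSigmaFinEquiv)).trans finSigmaFinEquiv)
      (comp (comp f g)
        (fun x => h (finSigmaFinEquiv.symm x).1 (finSigmaFinEquiv.symm x).2))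
      = comp f (fun i => comp (g i) (h i))
  comp_relabel_left : ∀ {k l : ℕ} {j : Fin l → ℕ} (σ : Fin k ≃ Fin l)
    (f : space k) (g : ∀ i, space (j i)),
    comp (relabel σ f) g =
      relabel (finSigmaFinEquiv.symm.trans <|
          (Equiv.sigmaCongrLeft (β := fun i => Fin (j i)) σ).trans finSigmaFinEquiv)
        (comp f (fun i => g (σ i)))
  comp_relabel_right : ∀ {k : ℕ} {j j' : Fin k → ℕ} (τ : ∀ i, Fin (j i) ≃ Fin (j' i))
    (f : space k) (g : ∀ i, space (j i)),
    comp f (fun i => relabel (τ i) (g i)) =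
      relabel (finSigmaFinEquiv.symm.trans <|
          (Equiv.sigmaCongrRight τ).trans finSigmaFinEquiv)
        (comp f g)

attribute [instance] TopOperad.top

/-- Morphisms of topological symmetric operads. -/
structure TopOperad.Hom (P Q : TopOperad) where
  /-- the map in arity `k` -/
  app : ∀ k, C(P.space k, Q.space k)
  map_unit : app 1 P.unit = Q.unit
  map_comp : ∀ {k : ℕ} {j : Fin k → ℕ} (f : P.space k) (g : ∀ i, P.space (j i)),
    app _ (P.comp f g) = Q.comp (app k f) (fun i => app (j i) (g i))
  map_relabel : ∀ {k l : ℕ} (e : Fin k ≃ Fin l) (f : P.space k),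
    app l (P.relabel e f) = Q.relabel e (app k f)

/-- A morphism of operads which is a homotopy equivalence of spaces in every arity. -/
def TopOperad.Hom.IsEquivalence {P Q : TopOperad} (F : P.Hom Q) : Prop :=
  ∀ k, ∃ e : ContinuousMap.HomotopyEquiv (P.space k) (Q.space k), e.toFun = F.app k

/-- Two topological operads are homotopy equivalent if they are connected by a finite zigzag
of operad morphisms each of which is a homotopy equivalence in every arity. -/
def TopOperad.HomotopyEquivalent : TopOperad → TopOperad → Prop :=
  Relation.EqvGen (fun P Q => ∃ F : P.Hom Q, F.IsEquivalence)

/-! ## Orthogonal categories with one object, and prefactorization -/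

/-- An orthogonal category with one object, enriched in topological spaces: a topological
monoid `M` of endomorphisms (multiplication is composition), with a relation `perp` which is
symmetric and stable under composition. -/
structure OrthMonoid where
  M : Type
  monoid : Monoid M
  top : TopologicalSpace M
  continuousMul : ContinuousMul M
  perp : M → M → Prop
  perp_symm : ∀ {f g : M}, perp f g → perp g f
  perp_stable : ∀ {f₁ f₂ : M} (g h₁ h₂ : M), perp f₁ f₂ → perp (g * f₁ * h₁) (g * f₂ * h₂)

attribute [instance] OrthMonoid.monoid OrthMonoid.top OrthMonoid.continuousMul

/-- The family of composites `f i ∘ g i l`, listed in lexicographic order. -/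
def glue {M : Type} [Mul M] {k : ℕ} {j : Fin k → ℕ} (f : Fin k → M) (g : ∀ i, Fin (j i) → M)
    (x : Fin (∑ i, j i)) : M :=
  f (finSigmaFinEquiv.symm x).1 * g (finSigmaFinEquiv.symm x).1 (finSigmaFinEquiv.symm x).2

theorem glue_apply {M : Type} [Mul M] {k : ℕ} {j : Fin k → ℕ} (f : Fin k → M)
    (g : ∀ i, Fin (j i) → M) (y : Σ i, Fin (j i)) :
    glue f g (finSigmaFinEquiv y) = f y.1 * g y.1 y.2 := by
  have h : ∀ z : Σ i, Fin (j i), z = y → f z.1 * g z.1 z.2 = f y.1 * g y.1 y.2 := by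
    rintro z rfl; rfl
  exact h _ (Equiv.symm_apply_apply _ _)

theorem relabel_eq {M : Type} {k l : ℕ} (e : Fin k ≃ Fin l) {F : Fin k → M} {G : Fin l → M}
    (h : ∀ x, F x = G (e x)) : F ∘ e.symm = G := by
  funext y
  simp [h]

theorem relabel_glue_eq {M : Type} [Mul M] {k l : ℕ} {j : Fin k → ℕ} (f : Fin k → M)
    (g : ∀ i, Fin (j i) → M) (e : (Σ i, Fin (j i)) ≃ Fin l) {G : Fin l → M}
    (h : ∀ y : Σ i, Fin (j i), f y.1 * g y.1 y.2 = G (e y)) :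
    glue f g ∘ (finSigmaFinEquiv.symm.trans e).symm = G := by
  refine relabel_eq _ fun x => ?_
  obtain ⟨y, rfl⟩ := finSigmaFinEquiv.surjective x
  rw [glue_apply, h, Equiv.trans_apply, Equiv.symm_apply_apply]

/-- The prefactorization operad: its operations of arity `k` are the `k`-tuples of pairwise
orthogonal morphisms, with the subspace topology of the product. -/
def OrthMonoid.prefact (C : OrthMonoid) : TopOperad where
  space k := {f : Fin k → C.M // ∀ i j, i ≠ j → C.perp (f i) (f j)}
  top _ := inferInstance
  unit := ⟨fun _ => 1, fun i j h => absurd (Subsingleton.elim i j) h⟩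
  comp {k j} f g :=
    ⟨glue f.1 (fun i => (g i).1), by
      intro x y hxy
      obtain ⟨⟨a, b⟩, rfl⟩ := finSigmaFinEquiv.surjective x
      obtain ⟨⟨c, d⟩, rfl⟩ := finSigmaFinEquiv.surjective y
      rw [glue_apply, glue_apply]
      by_cases hac : a = c
      · subst hac
        have hbd : b ≠ d := fun h => hxy (by rw [h])
        simpa using C.perp_stable (f.1 a) 1 1 ((g a).2 b d hbd)
      · simpa using C.perp_stable 1 ((g a).1 b) ((g c).1 d) (f.2 a c hac)⟩
  relabel e f := ⟨f.1 ∘ e.symm, fun i j h => f.2 _ _ (fun h' => h (e.symm.injective h'))⟩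
  continuous_comp j := by
    refine Continuous.subtype_mk (continuous_pi fun x => ?_) _
    refine Continuous.mul ?_ ?_
    · exact (continuous_apply _).comp (continuous_subtype_val.comp continuous_fst)
    · exact (continuous_apply _).comp (continuous_subtype_val.comp
        ((continuous_apply _).comp continuous_snd))
  continuous_relabel e :=
    Continuous.subtype_mk ((continuous_pi fun x => continuous_apply (e.symm x)).comp
      continuous_subtype_val) _
  relabel_refl f := rfl
  relabel_trans e e' f := rfl
  comp_unit f := Subtype.ext <| by
    refine relabel_glue_eq f.1 (fun _ _ => 1) _ fun y => ?_
    exact mul_one _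
  unit_comp {k} f := Subtype.ext <| by
    refine relabel_glue_eq (fun _ : Fin 1 => 1) (fun _ => f.1) _ fun y => ?_
    obtain ⟨a, b⟩ := y
    obtain rfl := Subsingleton.elim a default
    exact one_mul _
  comp_assoc {k j m} f g h := Subtype.ext <| by
    refine relabel_glue_eq (glue f.1 (fun i => (g i).1))
      (fun x => (h (finSigmaFinEquiv.symm x).1 (finSigmaFinEquiv.symm x).2).1) _ fun y => ?_
    obtain ⟨x, z⟩ := y
    have h1 := glue_apply f.1 (fun i => glue (g i).1 (fun l => (h i l).1))
      ⟨(finSigmaFinEquiv.symm x).1, finSigmaFinEquiv ⟨(finSigmaFinEquiv.symm x).2, z⟩⟩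
    have h2 := glue_apply (g (finSigmaFinEquiv.symm x).1).1
      (fun l => (h (finSigmaFinEquiv.symm x).1 l).1) ⟨(finSigmaFinEquiv.symm x).2, z⟩
    exact (mul_assoc _ _ _).trans (h1.trans (congrArg (_ * ·) h2)).symm
  comp_relabel_left {k l j} σ f g := Subtype.ext <| Eq.symm <| by
    refine relabel_glue_eq f.1 (fun i => (g (σ i)).1) _ fun y => ?_
    refine Eq.trans ?_ (glue_apply (f.1 ∘ σ.symm) (fun i => (g i).1) ⟨σ y.1, y.2⟩).symm
    simp
  comp_relabel_right {k j j'} τ f g := Subtype.ext <| Eq.symm <| by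
    refine relabel_glue_eq f.1 (fun i => (g i).1) _ fun y => ?_
    refine Eq.trans ?_
      (glue_apply f.1 (fun i => (g i).1 ∘ (τ i).symm) ⟨y.1, τ y.1 y.2⟩).symm
    simp

/-! ## Rectilinear embeddings -/

/-- Euclidean space `ℝⁿ`. It also serves as the underlying space of Minkowski space. -/
abbrev E (n : ℕ) : Type := EuclideanSpace ℝ (Fin n)

/-- The space `Rect(X, X)` of rectilinear embeddings `x ↦ r x + b`, `r > 0`, of `X ⊆ ℝⁿ` into
itself, as a subspace of `C(X, X)` with the compact-open topology. -/
abbrev Rect {n : ℕ} (X : Set (E n)) : Type :=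
  {f : C(X, X) // ∃ r : ℝ, 0 < r ∧ ∃ b : E n, ∀ x : X, (f x : E n) = r • (x : E n) + b}

/-- Rectilinear embeddings form a monoid under composition. -/
instance {n : ℕ} (X : Set (E n)) : Monoid (Rect X) where
  mul f g := ⟨f.1.comp g.1, by
    obtain ⟨r, hr, b, h⟩ := f.2
    obtain ⟨s, hs, c, h'⟩ := g.2
    refine ⟨r * s, mul_pos hr hs, r • c + b, fun x => ?_⟩
    rw [ContinuousMap.comp_apply, h, h', smul_add, smul_smul, add_assoc]⟩
  one := ⟨ContinuousMap.id X, 1, one_pos, 0, fun x => by simp⟩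
  mul_assoc _ _ _ := rfl
  one_mul _ := rfl
  mul_one _ := rfl

instance {n : ℕ} (X : Set (E n)) [LocallyCompactSpace X] : ContinuousMul (Rect X) where
  continuous_mul := Continuous.subtype_mk (ContinuousMap.continuous_comp'.comp
    ((continuous_subtype_val.comp continuous_snd).prodMk
      (continuous_subtype_val.comp continuous_fst))) _

/-- The image `f(X)` of a rectilinear embedding, as a subset of `ℝⁿ`. -/
def Rect.image {n : ℕ} {X : Set (E n)} (f : Rect X) : Set (E n) :=
  Set.range fun x : X => (f.1 x : E n)

theorem Rect.image_mul_subset {n : ℕ} {X : Set (E n)} (f g : Rect X) :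
    (f * g).image ⊆ f.image := by
  rintro _ ⟨x, rfl⟩
  exact ⟨g.1 x, rfl⟩

/-! ## Little discs -/

/-- The closed Euclidean unit disc. -/
abbrev disc (n : ℕ) : Set (E n) := Metric.closedBall 0 1

/-- The orthogonal category of discs: `f ⟂ g` iff the interiors of `f(Dⁿ)` and `g(Dⁿ)` are
disjoint. -/
def Disc (n : ℕ) : OrthMonoid where
  M := Rect (disc n)
  monoid := inferInstance
  top := inferInstance
  continuousMul := inferInstance
  perp f g := Disjoint (interior f.image) (interior g.image)
  perp_symm h := h.symm
  perp_stable {f₁ f₂} g h₁ h₂ h := by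
    obtain ⟨r, hr, b, hg⟩ := g.2
    have key : ∀ f : Rect (disc n), (g * f).image =
        ((Homeomorph.smulOfNeZero r hr.ne').trans (Homeomorph.addRight b)) '' f.image := by
      intro f
      ext y
      constructor
      · rintro ⟨x, rfl⟩
        exact ⟨_, ⟨x, rfl⟩, (hg _).symm⟩
      · rintro ⟨_, ⟨x, rfl⟩, rfl⟩
        exact ⟨x, hg _⟩
    have h' : Disjoint (interior (g * f₁).image) (interior (g * f₂).image) := by
      rw [key, key, ← Homeomorph.image_interior, ← Homeomorph.image_interior]
      exact (Set.disjoint_image_iff (Homeomorph.injective _)).2 h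
    exact h'.mono (interior_mono (Rect.image_mul_subset _ _))
      (interior_mono (Rect.image_mul_subset _ _))

/-! ## Causal structure of Minkowski space `ℝ^{1,n-1}` -/

/-- The Minkowski form `η(v, w) = - v₀ w₀ + v₁ w₁ + ⋯ + vₙ₋₁ wₙ₋₁`. -/
def eta {n : ℕ} (v w : E n) : ℝ :=
  ∑ i : Fin n, (if (i : ℕ) = 0 then -1 else 1) * v i * w i

/-- The unit vector `(1, 0, …, 0)`, which gives the time orientation. -/
def timeUnit (n : ℕ) : E n := WithLp.toLp 2 fun i => if (i : ℕ) = 0 then 1 else 0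

/-- A vector is causal if it is timelike or null, the zero vector being excluded. -/
def IsCausalVector {n : ℕ} (v : E n) : Prop := v ≠ 0 ∧ eta v v ≤ 0

/-- A vector is timelike and future-directed. -/
def IsFutureTimelike {n : ℕ} (v : E n) : Prop := eta v v < 0 ∧ eta v (timeUnit n) < 0

/-- `γ : [0,1] → ℝ^{1,n-1}` is a differentiable curve from `p` to `q` whose tangent vectors all
satisfy `P`. -/
def IsCurve {n : ℕ} (P : E n → Prop) (γ : ℝ → E n) (p q : E n) : Prop :=
  γ 0 = p ∧ γ 1 = q ∧ ∀ t ∈ Icc (0 : ℝ) 1, ∃ v, P v ∧ HasDerivWithinAt γ v (Icc 0 1) t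

/-- `p` and `q` are joined by a causal curve, which may be the constant one if `p = q`. -/
def CausallyRelated {n : ℕ} (p q : E n) : Prop :=
  p = q ∨ ∃ γ, IsCurve IsCausalVector γ p q

/-- No causal curve joins a point of `S` and a point of `T`. -/
def CausallyDisjoint {n : ℕ} (S T : Set (E n)) : Prop :=
  ∀ p ∈ S, ∀ q ∈ T, ¬ CausallyRelated p q

/-- The chronological future `I⁺(p)`. -/
def chronFuture {n : ℕ} (p : E n) : Set (E n) := {q | ∃ γ, IsCurve IsFutureTimelike γ p q}

/-- The chronological past `I⁻(p)`. -/
def chronPast {n : ℕ} (p : E n) : Set (E n) := {q | ∃ γ, IsCurve IsFutureTimelike γ q p}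

/-- The standard open causal diamond `I⁻(1,0,…,0) ∩ I⁺(-1,0,…,0)`. -/
def diamond (n : ℕ) : Set (E n) := chronPast (timeUnit n) ∩ chronFuture (-timeUnit n)

theorem eta_smul_left {n : ℕ} (r : ℝ) (v w : E n) : eta (r • v) w = r * eta v w := by
  simp only [eta, PiLp.smul_apply, smul_eq_mul, Finset.mul_sum]
  exact Finset.sum_congr rfl fun i _ => by ring

theorem eta_smul_right {n : ℕ} (r : ℝ) (v w : E n) : eta v (r • w) = r * eta v w := by
  simp only [eta, PiLp.smul_apply, smul_eq_mul, Finset.mul_sum]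
  exact Finset.sum_congr rfl fun i _ => by ring

theorem IsCausalVector.smul {n : ℕ} {v : E n} (h : IsCausalVector v) {r : ℝ} (hr : r ≠ 0) :
    IsCausalVector (r • v) := by
  refine ⟨smul_ne_zero hr h.1, ?_⟩
  rw [eta_smul_left, eta_smul_right, ← mul_assoc]
  exact mul_nonpos_of_nonneg_of_nonpos (mul_self_nonneg r) h.2

theorem CausallyRelated.symm {n : ℕ} {p q : E n} (h : CausallyRelated p q) :
    CausallyRelated q p := by
  rcases h with rfl | ⟨γ, h0, h1, h⟩
  · exact Or.inl rfl
  refine Or.inr ⟨fun t => γ (1 - t), by simpa, by simpa, fun t ht => ?_⟩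
  obtain ⟨v, hv, hd⟩ := h (1 - t) ⟨by linarith [ht.2], by linarith [ht.1]⟩
  refine ⟨(-1 : ℝ) • v, hv.smul (by norm_num), ?_⟩
  exact hd.scomp t (((hasDerivAt_id t).const_sub 1).hasDerivWithinAt)
    fun s hs => ⟨by simpa using hs.2, by simpa using hs.1⟩

/-- Rectilinear maps preserve the causal structure. -/
theorem CausallyRelated.rect {n : ℕ} {p q : E n} (h : CausallyRelated p q) {r : ℝ} (hr : 0 < r)
    (b : E n) : CausallyRelated (r • p + b) (r • q + b) := by
  rcases h with rfl | ⟨γ, h0, h1, h⟩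
  · exact Or.inl rfl
  refine Or.inr ⟨fun t => r • γ t + b, by simp [h0], by simp [h1], fun t ht => ?_⟩
  obtain ⟨v, hv, hd⟩ := h t ht
  exact ⟨r • v, hv.smul hr.ne', (hd.const_smul r).add_const b⟩

theorem CausallyDisjoint.mono {n : ℕ} {S S' T T' : Set (E n)} (h : CausallyDisjoint S T)
    (hS : S' ⊆ S) (hT : T' ⊆ T) : CausallyDisjoint S' T' :=
  fun p hp q hq => h p (hS hp) q (hT hq)

/-- The orthogonal category with one object and morphisms `Rect(X, X)`, with `f ⟂ g` iff
`f(X)` and `g(X)` are causally disjoint in `ℝ^{1,n-1}`. -/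
def causalOrthMonoid {n : ℕ} (X : Set (E n)) [LocallyCompactSpace X] : OrthMonoid where
  M := Rect X
  monoid := inferInstance
  top := inferInstance
  continuousMul := inferInstance
  perp f g := CausallyDisjoint f.image g.image
  perp_symm h := fun p hp q hq hpq => h q hq p hp hpq.symm
  perp_stable {f₁ f₂} g h₁ h₂ h := by
    obtain ⟨r, hr, b, hg⟩ := g.2
    have h' : CausallyDisjoint (g * f₁).image (g * f₂).image := by
      rintro _ ⟨x, rfl⟩ _ ⟨y, rfl⟩ hxy
      refine h _ ⟨x, rfl⟩ _ ⟨y, rfl⟩ ?_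
      have e : ∀ (f : Rect X) (z : X),
          r⁻¹ • (((g * f).1 z : X) : E n) + -(r⁻¹ • b) = (f.1 z : E n) := by
        intro f z
        have : (((g * f).1 z : X) : E n) = r • (f.1 z : E n) + b := hg _
        rw [this, smul_add, smul_smul, inv_mul_cancel₀ hr.ne', one_smul, add_neg_cancel_right]
      have := hxy.rect (inv_pos.2 hr) (-(r⁻¹ • b))
      rwa [e, e] at this
    exact h'.mono (Rect.image_mul_subset _ _) (Rect.image_mul_subset _ _)

theorem eta_self {m : ℕ} (v : E (m + 1)) :
    eta v v = (∑ i : Fin m, v i.succ ^ 2) - v 0 ^ 2 := by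
  have : ∀ i : Fin m, (if ((i.succ : Fin (m + 1)) : ℕ) = 0 then (-1 : ℝ) else 1) = 1 :=
    fun i => if_neg (by simp)
  simp only [eta, Fin.sum_univ_succ, this]
  simp only [Fin.val_zero, if_true, one_mul, ← pow_two]
  ring

theorem eta_timeUnit {m : ℕ} (v : E (m + 1)) : eta v (timeUnit (m + 1)) = - v 0 := by
  simp [eta, timeUnit]

theorem isFutureTimelike_iff {m : ℕ} (v : E (m + 1)) :
    IsFutureTimelike v ↔ (∑ i : Fin m, v i.succ ^ 2) < v 0 ^ 2 ∧ 0 < v 0 := by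
  rw [IsFutureTimelike, eta_self, eta_timeUnit, sub_neg, neg_lt_zero]

theorem IsCurve.displacement {n : ℕ} {γ : ℝ → E n} {p q : E n}
    (h : IsCurve IsFutureTimelike γ p q) : IsFutureTimelike (q - p) := by
  obtain ⟨h0, h1, h⟩ := h
  rcases n with _ | m
  · obtain ⟨v, hv, -⟩ := h 0 (by simp)
    simp [IsFutureTimelike, eta] at hv
  have mono : ∀ a : Fin (m + 1) → ℝ, (∀ v : E (m + 1), IsFutureTimelike v → 0 < ∑ i, a i * v i) →
      0 < ∑ i, a i * (q - p) i := by
    intro a ha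
    choose! v hv hd using h
    have hd' : ∀ t ∈ Icc (0 : ℝ) 1, HasDerivWithinAt (fun t => ∑ i, a i * γ t i)
        (∑ i, a i * v t i) (Icc 0 1) t := fun t ht => by
      refine HasDerivWithinAt.fun_sum fun i _ => HasDerivWithinAt.const_mul _ ?_
      exact (EuclideanSpace.proj (𝕜 := ℝ) i).hasFDerivAt.comp_hasDerivWithinAt t (hd t ht)
    have hm := strictMonoOn_of_hasDerivWithinAt_pos (convex_Icc (0 : ℝ) 1)
      (fun t ht => (hd' t ht).continuousWithinAt)
      (fun t ht => (hd' t (interior_subset ht)).mono interior_subset)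
      (fun t ht => ha _ (hv t (interior_subset ht)))
    have := hm (by simp) (by simp) zero_lt_one
    simp only [h0, h1] at this
    simpa [mul_sub, Finset.sum_sub_distrib] using this
  rw [isFutureTimelike_iff]
  set d := q - p
  have hT : 0 < d 0 := by
    have := mono (Fin.cons 1 fun _ => 0) fun v hv => by
      simpa [Fin.sum_univ_succ] using ((isFutureTimelike_iff v).1 hv).2
    simpa [Fin.sum_univ_succ] using this
  refine ⟨?_, hT⟩
  set X := ∑ i : Fin m, d i.succ ^ 2 with hX
  have hX0 : 0 ≤ X := Finset.sum_nonneg fun i _ => sq_nonneg _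
  rcases hX0.eq_or_lt with h0 | hpos
  · rw [← h0]; positivity
  have hN : 0 < √X := Real.sqrt_pos.2 hpos
  have := mono (Fin.cons (√X) fun i => - d i.succ) fun v hv => by
    rw [isFutureTimelike_iff] at hv
    simp only [Fin.sum_univ_succ, Fin.cons_zero, Fin.cons_succ, neg_mul, Finset.sum_neg_distrib]
    have hc := Finset.sum_mul_sq_le_sq_mul_sq Finset.univ
      (fun i : Fin m => d i.succ) (fun i : Fin m => v i.succ)
    have : (∑ i : Fin m, d i.succ * v i.succ) < √X * v 0 := by
      refine lt_of_pow_lt_pow_left₀ 2 (by have := hv.2; positivity) (hc.trans_lt ?_)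
      rw [mul_pow, Real.sq_sqrt hX0]
      exact mul_lt_mul_of_pos_left hv.1 hpos
    linarith
  simp only [Fin.sum_univ_succ, Fin.cons_zero, Fin.cons_succ, neg_mul, Finset.sum_neg_distrib,
    ← pow_two] at this
  rw [← hX] at this
  have h2 := Real.sq_sqrt hX0
  have : √X < d 0 := by nlinarith
  nlinarith

theorem isCurve_segment {n : ℕ} {p q : E n} (h : IsFutureTimelike (q - p)) :
    IsCurve IsFutureTimelike (fun t : ℝ => p + t • (q - p)) p q := by
  refine ⟨by simp, by simp, fun t _ => ⟨q - p, h, ?_⟩⟩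
  simpa using (((hasDerivAt_id t).smul_const (q - p)).const_add p).hasDerivWithinAt

theorem mem_chronFuture {n : ℕ} {p q : E n} : q ∈ chronFuture p ↔ IsFutureTimelike (q - p) :=
  ⟨fun ⟨_, h⟩ => h.displacement, fun h => ⟨_, isCurve_segment h⟩⟩

theorem mem_chronPast {n : ℕ} {p q : E n} : q ∈ chronPast p ↔ IsFutureTimelike (p - q) :=
  ⟨fun ⟨_, h⟩ => h.displacement, fun h => ⟨_, isCurve_segment h⟩⟩

theorem isOpen_futureTimelike (n : ℕ) : IsOpen {v : E n | IsFutureTimelike v} := by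
  have h1 : Continuous fun v : E n => eta v v := by unfold eta; fun_prop
  have h2 : Continuous fun v : E n => eta v (timeUnit n) := by unfold eta; fun_prop
  exact (isOpen_lt h1 continuous_const).inter (isOpen_lt h2 continuous_const)

theorem isOpen_diamond (n : ℕ) : IsOpen (diamond n) := by
  have h : diamond n = (fun q => timeUnit n - q) ⁻¹' {v | IsFutureTimelike v} ∩
      (fun q => q - -timeUnit n) ⁻¹' {v | IsFutureTimelike v} := by
    ext q
    exact and_congr mem_chronPast mem_chronFuture
  rw [h]
  exact ((isOpen_futureTimelike n).preimage (by fun_prop)).inter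
    ((isOpen_futureTimelike n).preimage (by fun_prop))

instance (n : ℕ) : LocallyCompactSpace (diamond n) := (isOpen_diamond n).locallyCompactSpace

/-- The orthogonal category of causally disjoint discs in `ℝ^{1,n-1}`. -/
def CD (n : ℕ) : OrthMonoid := causalOrthMonoid (disc n)

/-- The orthogonal category of causally disjoint diamonds in `ℝ^{1,n-1}`. -/
def CDiam (n : ℕ) : OrthMonoid := causalOrthMonoid (diamond n)

end CausalOperad

end

noncomputable section

namespace CausalOperad

/-! A rectilinear embedding is a scale `r` and a centre `b = (t, x)`. Forgetting `t` gives a disc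
embedding with coordinates `(r, x)`, and since `(r, b)(s, c) = (rs, rc + b)` this is a monoid
homomorphism. Orthogonality of two embeddings depends only on the sum `ρ` of the scales and the
difference `c` of the centres. With `gap c` the spatial length minus the temporal one, it reads `ρ ≤
gap c` for diamonds (`CDiam_perp_iff`), `√2 ρ < gap c` for causal discs (`CD_perp_iff`), and `ρ ≤
‖x‖` for little discs (`Disc_perp_iff`), `x` now being the difference of the disc centres. These
rest on `causallyRelated_iff`: only the displacement of the endpoints of a causal curve matters. As
`gap c` is at most the spatial length of `c`, forgetting time preserves orthogonality. Conversely, a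
disc halved and placed at time zero is a causal disc or diamond, and `√2 / 2 < 1` keeps
orthogonality. The composites are homotopic to the identity by shrinking scales and contracting
time, which only decreases `ρ` and increases the gap. Everything acts entrywise, so every arity is
handled at once (`exists_isEquivalence_disc`). The two projections form the zigzag `CD → Disc ←
CDiam`. -/

/-! ## Maps of prefactorization operads -/

/-- A continuous monoid homomorphism which preserves orthogonality induces a morphism of
prefactorization operads. -/
def OrthMonoid.prefactMap {C D : OrthMonoid} (φ : C.M →* D.M) (hφ : Continuous φ)
    (hperp : ∀ f g, C.perp f g → D.perp (φ f) (φ g)) : C.prefact.Hom D.prefact where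
  app _ :=
    { toFun := fun f => ⟨fun i => φ (f.1 i), fun i j h => hperp _ _ (f.2 i j h)⟩
      continuous_toFun := Continuous.subtype_mk (continuous_pi fun i =>
        hφ.comp ((continuous_apply i).comp continuous_subtype_val)) _ }
  map_unit := Subtype.ext <| funext fun _ => φ.map_one
  map_comp _ _ := Subtype.ext <| funext fun _ => φ.map_mul _ _
  map_relabel _ _ := rfl

/-- A homotopy of self-maps preserving orthogonality, applied entrywise to tuples. -/
theorem OrthMonoid.homotopic_of_entrywise {C : OrthMonoid} {k : ℕ}
    (u v : C(C.prefact.space k, C.prefact.space k)) (H : unitInterval → C.M → C.M)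
    (hH : Continuous (Function.uncurry H)) (hperp : ∀ t f g, C.perp f g → C.perp (H t f) (H t g))
    (h0 : ∀ f i, (u f).1 i = H 0 (f.1 i)) (h1 : ∀ f i, (v f).1 i = H 1 (f.1 i)) :
    u.Homotopic v :=
  ⟨{ toFun := fun p => ⟨fun i => H p.1 (p.2.1 i), fun i j h => hperp _ _ _ (p.2.2 i j h)⟩
     continuous_toFun := Continuous.subtype_mk (continuous_pi fun i =>
        hH.comp (continuous_fst.prodMk
          ((continuous_apply i).comp (continuous_subtype_val.comp continuous_snd)))) _
     map_zero_left := fun f => Subtype.ext <| funext fun i => (h0 f i).symm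
     map_one_left := fun f => Subtype.ext <| funext fun i => (h1 f i).symm }⟩

/-- An orthogonality preserving homomorphism with a homotopy inverse (not necessarily
multiplicative), all homotopies preserving orthogonality, induces an equivalence of operads. -/
theorem OrthMonoid.prefactMap_isEquivalence {C D : OrthMonoid} (φ : C.M →* D.M)
    (hφ : Continuous φ) (hperp : ∀ f g, C.perp f g → D.perp (φ f) (φ g))
    (s : D.M → C.M) (hs : Continuous s) (hsperp : ∀ f g, D.perp f g → C.perp (s f) (s g))
    (H : unitInterval → C.M → C.M) (hH : Continuous (Function.uncurry H))
    (hHperp : ∀ t f g, C.perp f g → C.perp (H t f) (H t g))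
    (hH0 : ∀ f, H 0 f = f) (hH1 : ∀ f, H 1 f = s (φ f))
    (K : unitInterval → D.M → D.M) (hK : Continuous (Function.uncurry K))
    (hKperp : ∀ t f g, D.perp f g → D.perp (K t f) (K t g))
    (hK0 : ∀ f, K 0 f = f) (hK1 : ∀ f, K 1 f = φ (s f)) :
    (OrthMonoid.prefactMap φ hφ hperp).IsEquivalence := fun k =>
  ⟨{ toFun := (OrthMonoid.prefactMap φ hφ hperp).app k
     invFun :=
      { toFun := fun f => ⟨fun i => s (f.1 i), fun i j h => hsperp _ _ (f.2 i j h)⟩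
        continuous_toFun := Continuous.subtype_mk (continuous_pi fun i =>
          hs.comp ((continuous_apply i).comp continuous_subtype_val)) _ }
     left_inv := (OrthMonoid.homotopic_of_entrywise _ _ H hH hHperp
        (fun f i => (hH0 (f.1 i)).symm) (fun f i => (hH1 (f.1 i)).symm)).symm
     right_inv := (OrthMonoid.homotopic_of_entrywise _ _ K hK hKperp
        (fun f i => (hK0 (f.1 i)).symm) (fun f i => (hK1 (f.1 i)).symm)).symm }, rfl⟩

/-! ## Coordinates on spaces of rectilinear embeddings -/

namespace Rect

variable {n : ℕ} {X : Set (E n)}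

/-- The scaling factor `r` of `x ↦ r x + b`. -/
def scale (f : Rect X) : ℝ := f.2.choose

/-- The translation part `b` of `x ↦ r x + b`. -/
def center (f : Rect X) : E n := f.2.choose_spec.2.choose

theorem scale_pos (f : Rect X) : 0 < f.scale := f.2.choose_spec.1

theorem apply_eq (f : Rect X) (x : X) : (f.1 x : E n) = f.scale • (x : E n) + f.center :=
  f.2.choose_spec.2.choose_spec x

theorem mapsTo (f : Rect X) : MapsTo (fun x => f.scale • x + f.center) X X := fun x hx => by
  have := (f.1 ⟨x, hx⟩).2
  rwa [f.apply_eq] at this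

theorem image_eq (f : Rect X) : f.image = (fun x => f.scale • x + f.center) '' X := by
  ext y
  constructor
  · rintro ⟨x, rfl⟩
    exact ⟨x, x.2, (f.apply_eq x).symm⟩
  · rintro ⟨x, hx, rfl⟩
    exact ⟨⟨x, hx⟩, f.apply_eq ⟨x, hx⟩⟩

/-- The rectilinear embedding with given coordinates. -/
def ofCoord (r : ℝ) (b : E n) (hr : 0 < r) (h : MapsTo (fun x => r • x + b) X X) : Rect X :=
  ⟨⟨fun x => ⟨r • (x : E n) + b, h x.2⟩, by fun_prop⟩, r, hr, b, fun _ => rfl⟩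

theorem ext_coord {f g : Rect X} (hs : f.scale = g.scale) (hc : f.center = g.center) :
    f = g := by
  refine Subtype.ext (ContinuousMap.ext fun x => Subtype.ext ?_)
  rw [f.apply_eq, g.apply_eq, hs, hc]

/-- Joint continuity of `(y, x) ↦ F y x` suffices for the compact-open topology, and this is visible
in coordinates. -/
theorem continuous_of_coord {Y : Type*} [TopologicalSpace Y] {F : Y → Rect X}
    (hs : Continuous fun y => (F y).scale) (hc : Continuous fun y => (F y).center) :
    Continuous F := by
  refine Continuous.subtype_mk (f := fun y => (F y).1)
    (ContinuousMap.continuous_of_continuous_uncurry _ (Continuous.subtype_mk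
      (f := fun p : Y × X => ((F p.1).1 p.2 : E n)) ?_ _)) _
  simp only [apply_eq]
  exact ((hs.comp continuous_fst).smul (continuous_subtype_val.comp continuous_snd)).add
    (hc.comp continuous_fst)

end Rect

/-- `N` measures how far from the origin a rescaled copy of `X` may be centred inside `X`:
`r X + b ⊆ X` iff `r + N b ≤ 1`. -/
structure IsGauge {n : ℕ} (X : Set (E n)) (N : E n → ℝ) : Prop where
  zero_mem : 0 ∈ X
  exists_ne_zero : ∃ v ∈ X, v ≠ 0
  mapsTo_iff : ∀ r : ℝ, 0 < r → ∀ b, MapsTo (fun x => r • x + b) X X ↔ r + N b ≤ 1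

namespace IsGauge

variable {n : ℕ} {X : Set (E n)} {N : E n → ℝ}

theorem scale_add_le (hX : IsGauge X N) (f : Rect X) : f.scale + N f.center ≤ 1 :=
  (hX.mapsTo_iff _ f.scale_pos _).1 f.mapsTo

/-- The rectilinear embedding with given coordinates. -/
def rect (hX : IsGauge X N) (r : ℝ) (b : E n) (hr : 0 < r) (h : r + N b ≤ 1) : Rect X :=
  Rect.ofCoord r b hr ((hX.mapsTo_iff r hr b).2 h)

theorem center_eq (hX : IsGauge X N) (f : Rect X) : f.center = f.1 ⟨0, hX.zero_mem⟩ := by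
  rw [f.apply_eq]; simp

theorem scale_eq (hX : IsGauge X N) {v : E n} (hv : v ∈ X) (hv0 : v ≠ 0) (f : Rect X) :
    f.scale = ‖(f.1 ⟨v, hv⟩ : E n) - f.1 ⟨0, hX.zero_mem⟩‖ / ‖v‖ := by
  rw [f.apply_eq, f.apply_eq]
  simp [norm_smul, abs_of_pos f.scale_pos, hv0]

theorem continuous_apply_coe (x : X) : Continuous fun f : Rect X => (f.1 x : E n) :=
  continuous_subtype_val.comp ((continuous_eval_const x).comp continuous_subtype_val)

theorem continuous_center (hX : IsGauge X N) : Continuous (Rect.center : Rect X → E n) :=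
  (continuous_apply_coe ⟨0, hX.zero_mem⟩).congr fun f => (hX.center_eq f).symm

theorem continuous_scale (hX : IsGauge X N) : Continuous (Rect.scale : Rect X → ℝ) := by
  obtain ⟨v, hv, hv0⟩ := hX.exists_ne_zero
  exact ((((continuous_apply_coe ⟨v, hv⟩).sub
    (continuous_apply_coe ⟨0, hX.zero_mem⟩)).norm).div_const ‖v‖).congr
      fun f => (hX.scale_eq hv hv0 f).symm

/-- `scale` and `center` come from choice; the values at `0` and at one nonzero point of `X` force
them, which makes them computable. -/
theorem coord_eq (hX : IsGauge X N) (f : Rect X) {r : ℝ} {b : E n} (hr : 0 < r)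
    (h : ∀ x : X, (f.1 x : E n) = r • (x : E n) + b) : f.scale = r ∧ f.center = b := by
  obtain ⟨v, hv, hv0⟩ := hX.exists_ne_zero
  rw [hX.scale_eq hv hv0, hX.center_eq, h, h]
  simp [norm_smul, abs_of_pos hr, hv0]

@[simp] theorem scale_rect (hX : IsGauge X N) (r : ℝ) (b : E n) (hr : 0 < r)
    (h : r + N b ≤ 1) : (hX.rect r b hr h).scale = r :=
  (hX.coord_eq _ hr fun _ => rfl).1

@[simp] theorem center_rect (hX : IsGauge X N) (r : ℝ) (b : E n) (hr : 0 < r)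
    (h : r + N b ≤ 1) : (hX.rect r b hr h).center = b :=
  (hX.coord_eq _ hr fun _ => rfl).2

theorem coord_mul (hX : IsGauge X N) (f g : Rect X) : (f * g).scale = f.scale * g.scale ∧
    (f * g).center = f.scale • g.center + f.center :=
  hX.coord_eq _ (mul_pos f.scale_pos g.scale_pos) fun x => by
    have : ((f * g).1 x : E n) = f.1 (g.1 x) := rfl
    rw [this, f.apply_eq, g.apply_eq, smul_add, smul_smul, add_assoc]

theorem coord_one (hX : IsGauge X N) : (1 : Rect X).scale = 1 ∧ (1 : Rect X).center = 0 :=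
  hX.coord_eq _ one_pos fun x => by
    have : ((1 : Rect X).1 x : E n) = x := rfl
    simp [this]

end IsGauge

/-! ## Little discs in coordinates -/

theorem isGauge_disc (m : ℕ) : IsGauge (disc (m + 1)) norm where
  zero_mem := by simp
  exists_ne_zero := ⟨EuclideanSpace.single 0 1, by simp, by simp⟩
  mapsTo_iff r hr b := by
    constructor
    · intro h
      -- The boundary point in the direction of `b` is moved farthest out; for `b = 0` any unit
      -- vector will do.
      obtain ⟨v, hv, hb⟩ : ∃ v : E (m + 1), ‖v‖ = 1 ∧ b = ‖b‖ • v := by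
        rcases eq_or_ne b 0 with rfl | hb
        · exact ⟨EuclideanSpace.single 0 1, by simp, by simp⟩
        · exact ⟨‖b‖⁻¹ • b, by simp [norm_smul, hb], by simp [smul_smul, hb]⟩
      have h1 : r • v + b = (r + ‖b‖) • v := by rw [add_smul, ← hb]
      have h2 : r • v + b ∈ disc (m + 1) := h (by simp [hv])
      rw [h1, mem_closedBall_zero_iff, norm_smul, hv, mul_one] at h2
      exact (le_abs_self _).trans h2
    · intro h x hx
      rw [mem_closedBall_zero_iff] at hx ⊢
      refine (norm_add_le _ _).trans ?_
      rw [norm_smul, Real.norm_of_nonneg hr.le]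
      nlinarith

open Pointwise in
theorem Rect.image_disc {n : ℕ} (f : Rect (disc n)) :
    f.image = Metric.closedBall f.center f.scale := by
  rw [f.image_eq]
  have h : (fun x => f.scale • x + f.center) = (fun x => x + f.center) ∘ fun x => f.scale • x :=
    rfl
  rw [h, image_comp]
  change (· + f.center) '' (f.scale • Metric.closedBall (0 : E n) 1) = _
  rw [smul_unitClosedBall_of_nonneg f.scale_pos.le]
  simp

/-- Only interiors must be disjoint, so tangent discs are allowed and the inequality is not strict.
-/
theorem Disc_perp_iff {n : ℕ} (f g : Rect (disc n)) :
    (Disc n).perp f g ↔ f.scale + g.scale ≤ ‖f.center - g.center‖ := by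
  change Disjoint (interior f.image) (interior g.image) ↔ _
  rw [f.image_disc, g.image_disc, interior_closedBall _ f.scale_pos.ne',
    interior_closedBall _ g.scale_pos.ne', disjoint_ball_ball_iff f.scale_pos g.scale_pos,
    dist_eq_norm]

/-! ## Time and space components -/

/-- The spatial part of a vector of Minkowski space. -/
def space {m : ℕ} : E (m + 1) →ₗ[ℝ] E m where
  toFun v := WithLp.toLp 2 fun i => v i.succ
  map_add' _ _ := rfl
  map_smul' _ _ := rfl

/-- The vector with given time and space components. -/
def ofTimeSpace {m : ℕ} (t : ℝ) (x : E m) : E (m + 1) :=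
  WithLp.toLp 2 (Fin.cons t x : Fin (m + 1) → ℝ)

section Components

variable {m : ℕ}

@[simp] theorem ofTimeSpace_zero (t : ℝ) (x : E m) : ofTimeSpace t x 0 = t := rfl

@[simp] theorem space_ofTimeSpace (t : ℝ) (x : E m) : space (ofTimeSpace t x) = x := rfl

theorem continuous_space : Continuous (space : E (m + 1) → E m) :=
  LinearMap.continuous_of_finiteDimensional _

theorem continuous_ofTimeSpace :
    Continuous fun p : ℝ × E m => ofTimeSpace p.1 p.2 := by
  refine (PiLp.continuous_toLp 2 _).comp (continuous_pi fun i => ?_)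
  refine Fin.cases ?_ (fun i => ?_) i
  · exact continuous_fst
  · simp only [Fin.cons_succ]; fun_prop

theorem ofTimeSpace_time_space (v : E (m + 1)) : ofTimeSpace (v 0) (space v) = v := by
  ext i
  refine Fin.cases ?_ (fun i => ?_) i <;> rfl

theorem norm_space_sq (v : E (m + 1)) : ‖space v‖ ^ 2 = ∑ i : Fin m, v i.succ ^ 2 := by
  rw [EuclideanSpace.real_norm_sq_eq]; rfl

theorem norm_sq_eq (v : E (m + 1)) : ‖v‖ ^ 2 = v 0 ^ 2 + ‖space v‖ ^ 2 := by
  rw [norm_space_sq, EuclideanSpace.real_norm_sq_eq, Fin.sum_univ_succ]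

theorem eta_self_eq (v : E (m + 1)) : eta v v = ‖space v‖ ^ 2 - v 0 ^ 2 := by
  rw [norm_space_sq, eta_self]

/-- How far a vector is from being causal: the length of its space component minus the length
of its time component. -/
def gap (v : E (m + 1)) : ℝ := ‖space v‖ - |v 0|

theorem eta_self_nonpos_iff (v : E (m + 1)) : eta v v ≤ 0 ↔ gap v ≤ 0 := by
  rw [eta_self_eq, gap, sub_nonpos, sub_nonpos, sq_le_sq, abs_norm]

/-! ## Causal relations in Minkowski space -/

theorem IsCausalVector.time_ne_zero {v : E (m + 1)} (h : IsCausalVector v) : v 0 ≠ 0 := by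
  intro h0
  have h1 := (eta_self_nonpos_iff v).1 h.2
  rw [gap, h0, abs_zero, sub_zero, norm_le_zero_iff] at h1
  apply h.1
  rw [← ofTimeSpace_time_space v, h0, h1]
  ext i
  refine Fin.cases ?_ (fun i => ?_) i <;> rfl

/-- With `x` the spatial displacement and `σ` the time direction of the curve, Cauchy–Schwarz makes
`‖x‖ σ t - ⟨x, space γ⟩` nondecreasing along `γ`, where `t` is its time coordinate. Comparing the
ends gives `‖x‖² ≤ ‖x‖ |Δt|`. -/
theorem IsCurve.gap_nonpos {γ : ℝ → E (m + 1)} {p q : E (m + 1)}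
    (h : IsCurve IsCausalVector γ p q) : gap (q - p) ≤ 0 := by
  obtain ⟨h0, h1, h⟩ := h
  choose! v hv hd using h
  have hdt : ∀ t ∈ Icc (0 : ℝ) 1, HasDerivWithinAt (fun t => γ t 0) (v t 0) (Icc 0 1) t :=
    fun t ht => (EuclideanSpace.proj (𝕜 := ℝ) (0 : Fin (m + 1))).hasFDerivAt.comp_hasDerivWithinAt
      t (hd t ht)
  have hds : ∀ t ∈ Icc (0 : ℝ) 1, HasDerivWithinAt (fun t => space (γ t)) (space (v t))
      (Icc 0 1) t := fun t ht =>
    (LinearMap.toContinuousLinearMap (space (m := m))).hasFDerivAt.comp_hasDerivWithinAt t (hd t ht)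
  -- The derivative need not be continuous, but by Darboux a nowhere vanishing time derivative has
  -- constant sign.
  obtain ⟨σ, hσ, hpos⟩ : ∃ σ : ℝ, |σ| = 1 ∧ ∀ t ∈ Icc (0 : ℝ) 1, |v t 0| = σ * v t 0 := by
    rcases hasDerivWithinAt_forall_lt_or_forall_gt_of_forall_ne (convex_Icc (0 : ℝ) 1) hdt
      (fun t ht => (hv t ht).time_ne_zero) with h | h
    · exact ⟨-1, by simp, fun t ht => by rw [abs_of_neg (h t ht)]; ring⟩
    · exact ⟨1, by simp, fun t ht => by rw [abs_of_pos (h t ht)]; ring⟩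
  set x := space (q - p) with hx
  have hmono : MonotoneOn (fun t => ‖x‖ * (σ * γ t 0) - inner ℝ x (space (γ t))) (Icc 0 1) := by
    have hd' : ∀ t ∈ Icc (0 : ℝ) 1, HasDerivWithinAt
        (fun t => ‖x‖ * (σ * γ t 0) - inner ℝ x (space (γ t)))
        (‖x‖ * (σ * v t 0) - inner ℝ x (space (v t))) (Icc 0 1) t := fun t ht =>
      (((hdt t ht).const_mul σ).const_mul ‖x‖).sub
        ((innerSL ℝ x).hasFDerivAt.comp_hasDerivWithinAt t (hds t ht))
    refine monotoneOn_of_hasDerivWithinAt_nonneg (convex_Icc 0 1)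
      (fun t ht => (hd' t ht).continuousWithinAt)
      (fun t ht => (hd' t (interior_subset ht)).mono interior_subset) fun t ht => ?_
    have ht := interior_subset ht
    rw [← hpos t ht]
    have h1 := real_inner_le_norm x (space (v t))
    have h2 : ‖space (v t)‖ ≤ |v t 0| := sub_nonpos.1 ((eta_self_nonpos_iff _).1 (hv t ht).2)
    nlinarith [norm_nonneg x]
  have h2 := hmono (by simp) (by simp) zero_le_one
  simp only [h0, h1] at h2
  have h3 : ‖x‖ * ‖x‖ ≤ ‖x‖ * |(q - p) 0| := by
    have h4 : inner ℝ x (space q) - inner ℝ x (space p) = ‖x‖ * ‖x‖ := by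
      rw [← inner_sub_right, ← map_sub, ← hx, real_inner_self_eq_norm_mul_norm]
    have h5 : σ * (q - p) 0 ≤ |(q - p) 0| := by
      refine (le_abs_self _).trans ?_
      rw [abs_mul, hσ, one_mul]
    have h6 : (q - p) 0 = q 0 - p 0 := rfl
    have h7 := mul_le_mul_of_nonneg_left h5 (norm_nonneg x)
    rw [h6] at h7 ⊢
    linarith
  rw [gap, ← hx, sub_nonpos]
  rcases (norm_nonneg x).eq_or_lt with h | h
  · rw [← h]; positivity
  · exact le_of_mul_le_mul_left h3 h

theorem causallyRelated_iff {p q : E (m + 1)} : CausallyRelated p q ↔ gap (q - p) ≤ 0 := by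
  constructor
  · rintro (rfl | ⟨γ, h⟩)
    · simp [gap]
    · exact h.gap_nonpos
  · intro h
    rcases eq_or_ne p q with rfl | hne
    · exact Or.inl rfl
    · refine Or.inr ⟨fun t : ℝ => p + t • (q - p), by simp, by simp, fun t _ => ⟨q - p,
        ⟨sub_ne_zero.2 hne.symm, (eta_self_nonpos_iff _).2 h⟩, ?_⟩⟩
      simpa using (((hasDerivAt_id t).smul_const (q - p)).const_add p).hasDerivWithinAt

end Components

/-! ## Projection to little discs -/

section Projection

variable {m : ℕ} {X : Set (E (m + 2))} {N : E (m + 2) → ℝ}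

theorem IsGauge.scale_add_norm_space_le (hX : IsGauge X N) (hN : ∀ b, ‖space b‖ ≤ N b)
    (f : Rect X) : f.scale + ‖space f.center‖ ≤ 1 :=
  (add_le_add_right (hN _) _).trans (hX.scale_add_le f)

/-- Forgetting the time component of the centre is a homomorphism to the monoid of discs. -/
def IsGauge.projection (hX : IsGauge X N) (hN : ∀ b, ‖space b‖ ≤ N b) :
    Rect X →* Rect (disc (m + 1)) where
  toFun f := (isGauge_disc m).rect f.scale (space f.center) f.scale_pos
    (hX.scale_add_norm_space_le hN f)
  map_one' := Rect.ext_coord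
    (by simp [hX.coord_one, (isGauge_disc m).coord_one])
    (by simp [hX.coord_one, (isGauge_disc m).coord_one])
  map_mul' f g := Rect.ext_coord
    (by simp [hX.coord_mul f g, (isGauge_disc m).coord_mul])
    (by simp [hX.coord_mul f g, (isGauge_disc m).coord_mul])

theorem IsGauge.scale_projection (hX : IsGauge X N) (hN : ∀ b, ‖space b‖ ≤ N b) (f : Rect X) :
    (hX.projection hN f).scale = f.scale :=
  ((isGauge_disc m).coord_eq _ f.scale_pos fun _ => rfl).1

theorem IsGauge.center_projection (hX : IsGauge X N) (hN : ∀ b, ‖space b‖ ≤ N b) (f : Rect X) :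
    (hX.projection hN f).center = space f.center :=
  ((isGauge_disc m).coord_eq _ f.scale_pos fun _ => rfl).2

/-- Scaling all times by one factor `c ≤ 1` contracts time differences and leaves spatial ones
alone; this is why `shrink` preserves orthogonality. -/
theorem gap_sub_le_gap_shrink_sub {c : ℝ} (hc : c ∈ Icc (0 : ℝ) 1) (b b' : E (m + 2)) :
    gap (b - b') ≤
      gap (ofTimeSpace (c * b 0) (space b) - ofTimeSpace (c * b' 0) (space b')) := by
  have h := mul_le_of_le_one_left (abs_nonneg (b 0 - b' 0)) hc.2
  simp only [gap, map_sub, space_ofTimeSpace, PiLp.sub_apply, ofTimeSpace_zero, ← mul_sub,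
    abs_mul, abs_of_nonneg hc.1]
  linarith

theorem gap_ofTimeSpace_zero_sub (x y : E (m + 1)) :
    gap (ofTimeSpace 0 x - ofTimeSpace 0 y) = ‖x - y‖ := by
  simp [gap]

theorem one_sub_mem_Icc (t : unitInterval) : 1 - (t : ℝ) ∈ Icc (0 : ℝ) 1 :=
  ⟨by linarith [t.2.2], by linarith [t.2.1]⟩

theorem one_sub_half_pos (t : unitInterval) : 0 < 1 - (t : ℝ) / 2 := by linarith [t.2.2]

theorem one_sub_half_mul_le (t : unitInterval) {r : ℝ} (hr : 0 < r) :
    (1 - (t : ℝ) / 2) * r ≤ r :=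
  mul_le_of_le_one_left hr.le (by linarith [t.2.1])

/-- Halving discs and placing them at time zero: a homotopy inverse of the projection. -/
def IsGauge.timeZero (hX : IsGauge X N) (hN : ∀ x, N (ofTimeSpace 0 x) ≤ ‖x‖)
    (g : Rect (disc (m + 1))) : Rect X :=
  hX.rect (g.scale / 2) (ofTimeSpace 0 g.center) (half_pos g.scale_pos) <| by
    have h1 := (isGauge_disc m).scale_add_le g
    have h2 := hN g.center
    have h3 := g.scale_pos
    linarith

/-- The homotopy which shrinks embeddings to half their size while moving them to time zero. -/
def IsGauge.shrink (hX : IsGauge X N)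
    (hN : ∀ c ∈ Icc (0 : ℝ) 1, ∀ b, N (ofTimeSpace (c * b 0) (space b)) ≤ N b)
    (t : unitInterval) (f : Rect X) : Rect X :=
  hX.rect ((1 - (t : ℝ) / 2) * f.scale) (ofTimeSpace ((1 - (t : ℝ)) * f.center 0) (space f.center))
    (mul_pos (one_sub_half_pos t) f.scale_pos) <|
      (add_le_add (one_sub_half_mul_le t f.scale_pos) (hN _ (one_sub_mem_Icc t) _)).trans
        (hX.scale_add_le f)

/-- The homotopy which shrinks discs to half their size, keeping their centres. -/
def shrinkDisc (t : unitInterval) (g : Rect (disc (m + 1))) : Rect (disc (m + 1)) :=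
  (isGauge_disc m).rect ((1 - (t : ℝ) / 2) * g.scale) g.center
    (mul_pos (one_sub_half_pos t) g.scale_pos) <|
      (add_le_add_left (one_sub_half_mul_le t g.scale_pos) _).trans
        ((isGauge_disc m).scale_add_le g)

/-! ### Continuity of the projection, its homotopy inverse and the homotopies. -/

theorem IsGauge.continuous_projection (hX : IsGauge X N) (hN : ∀ b, ‖space b‖ ≤ N b) :
    Continuous (hX.projection hN) := by
  refine Rect.continuous_of_coord ?_ ?_
  · simp only [hX.scale_projection]
    exact hX.continuous_scale
  · simp only [hX.center_projection]
    exact continuous_space.comp hX.continuous_center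

theorem IsGauge.continuous_timeZero (hX : IsGauge X N) (hN : ∀ x, N (ofTimeSpace 0 x) ≤ ‖x‖) :
    Continuous (hX.timeZero hN) := by
  refine Rect.continuous_of_coord ?_ ?_
  · simp only [timeZero, hX.scale_rect]
    exact (isGauge_disc m).continuous_scale.div_const 2
  · simp only [timeZero, hX.center_rect]
    exact continuous_ofTimeSpace.comp
      (continuous_const.prodMk (isGauge_disc m).continuous_center)

theorem continuous_unitInterval_fst {Y : Type*} [TopologicalSpace Y] :
    Continuous fun p : unitInterval × Y => (p.1 : ℝ) :=
  continuous_subtype_val.comp continuous_fst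

theorem IsGauge.continuous_shrink (hX : IsGauge X N)
    (hN : ∀ c ∈ Icc (0 : ℝ) 1, ∀ b, N (ofTimeSpace (c * b 0) (space b)) ≤ N b) :
    Continuous (Function.uncurry (hX.shrink hN)) := by
  have h1 := hX.continuous_scale.comp (continuous_snd (X := unitInterval))
  have h2 := hX.continuous_center.comp (continuous_snd (X := unitInterval))
  have h3 := continuous_unitInterval_fst (Y := Rect X)
  have h4 : Continuous fun v : E (m + 2) => v 0 := by fun_prop
  refine Rect.continuous_of_coord ?_ ?_
  · simp only [shrink, Function.uncurry_def, hX.scale_rect]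
    exact (continuous_const.sub (h3.div_const 2)).mul h1
  · simp only [shrink, Function.uncurry_def, hX.center_rect]
    exact continuous_ofTimeSpace.comp
        (((continuous_const.sub h3).mul (h4.comp h2)).prodMk (continuous_space.comp h2))

theorem continuous_shrinkDisc : Continuous (Function.uncurry (shrinkDisc (m := m))) := by
  refine Rect.continuous_of_coord ?_ ?_
  · simp only [shrinkDisc, Function.uncurry_def, IsGauge.scale_rect]
    exact (continuous_const.sub (continuous_unitInterval_fst.div_const 2)).mul
        ((isGauge_disc m).continuous_scale.comp continuous_snd)
  · simp only [shrinkDisc, Function.uncurry_def, IsGauge.center_rect]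
    exact (isGauge_disc m).continuous_center.comp continuous_snd

/-! ### Endpoints of the homotopies. -/

theorem IsGauge.shrink_zero (hX : IsGauge X N)
    (hN : ∀ c ∈ Icc (0 : ℝ) 1, ∀ b, N (ofTimeSpace (c * b 0) (space b)) ≤ N b) (f : Rect X) :
    hX.shrink hN 0 f = f :=
  Rect.ext_coord (by simp [shrink]) (by simpa [shrink] using ofTimeSpace_time_space f.center)

theorem IsGauge.shrink_one (hX : IsGauge X N) (hN : ∀ b, ‖space b‖ ≤ N b)
    (hN₀ : ∀ x, N (ofTimeSpace 0 x) ≤ ‖x‖)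
    (hN₁ : ∀ c ∈ Icc (0 : ℝ) 1, ∀ b, N (ofTimeSpace (c * b 0) (space b)) ≤ N b) (f : Rect X) :
    hX.shrink hN₁ 1 f = hX.timeZero hN₀ (hX.projection hN f) := by
  refine Rect.ext_coord ?_ ?_
  · rw [shrink, timeZero, hX.scale_rect, hX.scale_rect, hX.scale_projection, Icc.coe_one]
    ring
  · rw [shrink, timeZero, hX.center_rect, hX.center_rect, hX.center_projection, Icc.coe_one,
      sub_self, zero_mul]

theorem shrinkDisc_zero (g : Rect (disc (m + 1))) : shrinkDisc 0 g = g :=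
  Rect.ext_coord (by simp [shrinkDisc]) (by simp [shrinkDisc])

theorem IsGauge.shrinkDisc_one (hX : IsGauge X N) (hN : ∀ b, ‖space b‖ ≤ N b)
    (hN₀ : ∀ x, N (ofTimeSpace 0 x) ≤ ‖x‖) (g : Rect (disc (m + 1))) :
    shrinkDisc 1 g = hX.projection hN (hX.timeZero hN₀ g) := by
  refine Rect.ext_coord ?_ ?_
  · rw [shrinkDisc, timeZero, IsGauge.scale_rect, hX.scale_projection, hX.scale_rect, Icc.coe_one]
    ring
  · rw [shrinkDisc, timeZero, IsGauge.center_rect, hX.center_projection, hX.center_rect,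
      space_ofTimeSpace]

/-- If orthogonality of rectilinear self-embeddings of `X` is a condition `P` on the sum of the
scales and the gap between the centres, which is at least as strong as orthogonality of the
spatial discs, and implied by it after halving, then the projection is an equivalence. -/
theorem exists_isEquivalence_disc [LocallyCompactSpace X] (hX : IsGauge X N)
    (hN : ∀ b, ‖space b‖ ≤ N b) (hN₀ : ∀ x, N (ofTimeSpace 0 x) ≤ ‖x‖)
    (hN₁ : ∀ c ∈ Icc (0 : ℝ) 1, ∀ b, N (ofTimeSpace (c * b 0) (space b)) ≤ N b)
    {P : ℝ → ℝ → Prop}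
    (hP : ∀ f g : Rect X, CausallyDisjoint f.image g.image ↔
      P (f.scale + g.scale) (gap (f.center - g.center)))
    (hPle : ∀ ρ d, 0 < ρ → P ρ d → ρ ≤ d)
    (hPmono : ∀ ρ ρ' d d', ρ' ≤ ρ → d ≤ d' → P ρ d → P ρ' d')
    (hPhalf : ∀ ρ d, 0 < ρ → ρ ≤ d → P (ρ / 2) d) :
    ∃ F : (causalOrthMonoid X).prefact.Hom (Disc (m + 1)).prefact, F.IsEquivalence := by
  have hproj : ∀ f g : Rect X, CausallyDisjoint f.image g.image →
      (Disc (m + 1)).perp (hX.projection hN f) (hX.projection hN g) := fun f g hfg => by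
    have h := hPle _ _ (add_pos f.scale_pos g.scale_pos) ((hP f g).1 hfg)
    rw [Disc_perp_iff, hX.scale_projection, hX.scale_projection, hX.center_projection,
      hX.center_projection, ← map_sub]
    exact h.trans (sub_le_self _ (abs_nonneg _))
  have hzero : ∀ f g : Rect (disc (m + 1)), (Disc (m + 1)).perp f g →
      CausallyDisjoint (hX.timeZero hN₀ f).image (hX.timeZero hN₀ g).image := fun f g hfg => by
    have h := hPhalf _ _ (add_pos f.scale_pos g.scale_pos) ((Disc_perp_iff f g).1 hfg)
    rw [hP, IsGauge.timeZero, IsGauge.timeZero, hX.scale_rect, hX.scale_rect, hX.center_rect,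
      hX.center_rect, gap_ofTimeSpace_zero_sub, ← add_div]
    exact h
  have hshrink : ∀ t, ∀ f g : Rect X, CausallyDisjoint f.image g.image →
      CausallyDisjoint (hX.shrink hN₁ t f).image (hX.shrink hN₁ t g).image := fun t f g hfg => by
    rw [hP, IsGauge.shrink, IsGauge.shrink, hX.scale_rect, hX.scale_rect, hX.center_rect,
      hX.center_rect]
    exact hPmono _ _ _ _ (add_le_add (one_sub_half_mul_le t f.scale_pos)
      (one_sub_half_mul_le t g.scale_pos)) (gap_sub_le_gap_shrink_sub (one_sub_mem_Icc t) _ _)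
      ((hP f g).1 hfg)
  have hdisc : ∀ t, ∀ f g : Rect (disc (m + 1)), (Disc (m + 1)).perp f g →
      (Disc (m + 1)).perp (shrinkDisc t f) (shrinkDisc t g) := fun t f g hfg => by
    rw [Disc_perp_iff, shrinkDisc, shrinkDisc, IsGauge.scale_rect, IsGauge.scale_rect,
      IsGauge.center_rect, IsGauge.center_rect]
    exact (add_le_add (one_sub_half_mul_le t f.scale_pos)
      (one_sub_half_mul_le t g.scale_pos)).trans ((Disc_perp_iff f g).1 hfg)
  exact ⟨_, OrthMonoid.prefactMap_isEquivalence (C := causalOrthMonoid X) (D := Disc (m + 1))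
    (hX.projection hN) (hX.continuous_projection hN) hproj
    (hX.timeZero hN₀) (hX.continuous_timeZero hN₀) hzero
    (hX.shrink hN₁) (hX.continuous_shrink hN₁) hshrink
    (hX.shrink_zero hN₁) (hX.shrink_one hN hN₀ hN₁)
    shrinkDisc continuous_shrinkDisc hdisc shrinkDisc_zero (hX.shrinkDisc_one hN hN₀)⟩

end Projection

/-! ## Causal disjointness of images -/

section Images

variable {m : ℕ}

/-- For convex symmetric `X` one has `r X - s X = (r + s) X`, so the differences of points of the
two images are the centre difference plus `(r + s) X`. -/
theorem Rect.causallyDisjoint_iff {X : Set (E (m + 1))} (hconv : Convex ℝ X)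
    (hneg : ∀ x ∈ X, -x ∈ X) (f g : Rect X) : CausallyDisjoint f.image g.image ↔
      ∀ u ∈ X, 0 < gap (f.center - g.center + (f.scale + g.scale) • u) := by
  have hr := f.scale_pos
  have hs := g.scale_pos
  rw [f.image_eq, g.image_eq]
  constructor
  · intro h u hu
    have h1 := h _ ⟨u, hu, rfl⟩ _ ⟨-u, hneg u hu, rfl⟩
    rw [← not_le]
    intro h2
    refine h1 (CausallyRelated.symm (causallyRelated_iff.2 ?_))
    refine le_of_eq_of_le (congrArg gap ?_) h2
    module
  · rintro h _ ⟨x, hx, rfl⟩ _ ⟨y, hy, rfl⟩ hxy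
    have h1 := causallyRelated_iff.1 hxy.symm
    have hu := hconv hx (hneg y hy) (div_nonneg hr.le (add_pos hr hs).le)
      (div_nonneg hs.le (add_pos hr hs).le) (by field_simp)
    refine (h _ hu).not_ge ?_
    refine le_of_eq_of_le (congrArg gap ?_) h1
    rw [smul_add, smul_smul, smul_smul, mul_div_cancel₀ _ (add_pos hr hs).ne',
      mul_div_cancel₀ _ (add_pos hr hs).ne']
    module

/-- Adding `v` lowers the gap by at most the temporal plus the spatial length of `v`. The supremum
of this quantity over `X` is the constant in the orthogonality criterion: `√2` for the ball, `1` for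
the diamond. -/
theorem gap_sub_le_gap_add (b v : E (m + 1)) :
    gap b - (|v 0| + ‖space v‖) ≤ gap (b + v) := by
  have h1 : ‖space b‖ ≤ ‖space (b + v)‖ + ‖space v‖ := by
    simpa using norm_sub_le (space (b + v)) (space v)
  have h2 : |(b + v) 0| ≤ |b 0| + |v 0| := abs_add_le _ _
  unfold gap
  linarith

theorem exists_abs_add_mul_eq (t : ℝ) :
    ∃ σ : ℝ, |σ| = 1 ∧ ∀ a, 0 ≤ a → |t + a * σ| = |t| + a := by
  rcases le_total 0 t with h | h
  · exact ⟨1, by simp, fun a ha => by rw [abs_of_nonneg h, abs_of_nonneg (by linarith)]; ring⟩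
  · exact ⟨-1, by simp, fun a ha => by rw [abs_of_nonpos h, abs_of_nonpos (by linarith)]; ring⟩

end Images

/-! ## Causally disjoint discs -/

section DiscImages

variable {m : ℕ}

theorem abs_time_add_norm_space_le (v : E (m + 1)) : |v 0| + ‖space v‖ ≤ √2 * ‖v‖ := by
  refine le_of_sq_le_sq ?_ (by positivity)
  rw [mul_pow, Real.sq_sqrt zero_le_two, norm_sq_eq, ← sq_abs (v 0)]
  nlinarith [sq_nonneg (|v 0| - ‖space v‖)]

/-- The largest drop of the gap over the ball of radius `ρ` is `√2 ρ`, reached at 45° to the time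
axis. The disc is closed, so the extremal point counts and the inequality is strict. -/
theorem CD_perp_iff (f g : Rect (disc (m + 1))) : CausallyDisjoint f.image g.image ↔
    √2 * (f.scale + g.scale) < gap (f.center - g.center) := by
  rw [Rect.causallyDisjoint_iff (convex_closedBall _ _) (fun x hx => by simpa using hx)]
  have hρ := add_pos f.scale_pos g.scale_pos
  set ρ := f.scale + g.scale
  set c := f.center - g.center
  constructor
  · intro h
    by_contra! hgap
    -- If the spatial distance is at most `ρ`, a purely spatial vector cancels it. Otherwise the 45°
    -- vector cannot overshoot the spatial origin, so the drop is exactly `√2 ρ`.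
    rcases le_or_gt ‖space c‖ ρ with hc | hc
    · refine (h (ofTimeSpace 0 (-(ρ⁻¹ • space c))) ?_).not_ge ?_
      · rw [mem_closedBall_zero_iff]
        refine le_of_sq_le_sq ?_ zero_le_one
        rw [norm_sq_eq, ofTimeSpace_zero, space_ofTimeSpace, norm_neg, norm_smul,
          Real.norm_of_nonneg (inv_pos.2 hρ).le, zero_pow two_ne_zero, zero_add]
        exact pow_le_pow_left₀ (by positivity) (by rwa [inv_mul_le_one₀ hρ]) 2
      · have h0 : space (c + ρ • ofTimeSpace 0 (-(ρ⁻¹ • space c))) = 0 := by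
          simp [smul_smul, hρ.ne']
        rw [gap, h0]
        simp
    · obtain ⟨σ, hσ, hσc⟩ := exists_abs_add_mul_eq (c 0)
      have hx : 0 < ‖space c‖ := hρ.trans hc
      have h2 : √2 ^ 2 = 2 := Real.sq_sqrt zero_le_two
      have h2' : √2 ≤ 2 := by nlinarith [Real.sqrt_nonneg 2]
      -- This unit vector lengthens time and shortens space by `√2 / 2` each.
      refine (h (ofTimeSpace (√2 / 2 * σ) (-((√2 / 2 / ‖space c‖) • space c))) ?_).not_ge ?_
      · rw [mem_closedBall_zero_iff]
        refine le_of_sq_le_sq ?_ zero_le_one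
        rw [norm_sq_eq, ofTimeSpace_zero, space_ofTimeSpace, norm_neg, norm_smul,
          Real.norm_of_nonneg (by positivity), div_mul_cancel₀ _ hx.ne', mul_pow, ← sq_abs σ, hσ,
          div_pow, h2]
        norm_num
      · have hs : space (c + ρ • ofTimeSpace (√2 / 2 * σ)
            (-((√2 / 2 / ‖space c‖) • space c))) =
            ((‖space c‖ - ρ * (√2 / 2)) / ‖space c‖) • space c := by
          rw [map_add, map_smul, space_ofTimeSpace, smul_neg, smul_smul, ← sub_eq_add_neg,
            sub_div, sub_smul, div_self hx.ne', one_smul, mul_div_assoc]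
        have ht : (c + ρ • ofTimeSpace (√2 / 2 * σ) (-((√2 / 2 / ‖space c‖) • space c))) 0 =
            c 0 + ρ * (√2 / 2) * σ := by
          simp [mul_assoc]
        rw [gap, hs, ht, hσc _ (by positivity), norm_smul, Real.norm_of_nonneg,
          div_mul_cancel₀ _ hx.ne']
        · rw [gap] at hgap
          linarith
        · exact div_nonneg (by nlinarith) hx.le
  · intro h u hu
    rw [mem_closedBall_zero_iff] at hu
    have h1 := gap_sub_le_gap_add c (ρ • u)
    have h2 := abs_time_add_norm_space_le (ρ • u)
    rw [norm_smul, Real.norm_of_nonneg hρ.le] at h2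
    have h3 : √2 * (ρ * ‖u‖) ≤ √2 * ρ :=
      mul_le_mul_of_nonneg_left (mul_le_of_le_one_right hρ.le hu) (Real.sqrt_nonneg 2)
    linarith

end DiscImages

theorem CD_homotopyEquivalent_Disc (m : ℕ) :
    (CD (m + 2)).prefact.HomotopyEquivalent (Disc (m + 1)).prefact := by
  have h2 : √2 ^ 2 = 2 := Real.sq_sqrt zero_le_two
  have hpos : 0 < √2 := by positivity
  refine Relation.EqvGen.rel _ _ (exists_isEquivalence_disc (isGauge_disc (m + 1))
    (fun b => ?_) (fun x => ?_) (fun c hc b => ?_) (P := fun ρ d => √2 * ρ < d) CD_perp_iff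
    (fun ρ d hρ h => ?_) (fun ρ ρ' d d' hρ hd h => ?_) (fun ρ d hρ h => ?_))
  · refine le_of_sq_le_sq ?_ (norm_nonneg _)
    rw [norm_sq_eq b]
    nlinarith [sq_nonneg (b 0)]
  · refine le_of_sq_le_sq ?_ (norm_nonneg _)
    rw [norm_sq_eq]
    simp
  · refine le_of_sq_le_sq ?_ (norm_nonneg _)
    rw [norm_sq_eq, norm_sq_eq b, ofTimeSpace_zero, space_ofTimeSpace, mul_pow]
    have : c ^ 2 ≤ 1 := pow_le_one₀ hc.1 hc.2
    nlinarith [sq_nonneg (b 0)]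
  · nlinarith
  · exact ((mul_le_mul_of_nonneg_left hρ hpos.le).trans_lt h).trans_le hd
  -- Halving beats the factor `√2`: `√2 (ρ / 2) < ρ ≤ d`.
  · nlinarith

/-! ## Causally disjoint diamonds -/

section DiamondImages

variable {m : ℕ}

/-- The norm on Minkowski space whose open unit ball is the standard diamond. -/
def diamondNorm (v : E (m + 1)) : ℝ := |v 0| + ‖space v‖

theorem diamondNorm_add_le (v w : E (m + 1)) :
    diamondNorm (v + w) ≤ diamondNorm v + diamondNorm w := by
  have h1 : |(v + w) 0| ≤ |v 0| + |w 0| := abs_add_le _ _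
  have h2 : ‖space (v + w)‖ ≤ ‖space v‖ + ‖space w‖ := by rw [map_add]; exact norm_add_le _ _
  unfold diamondNorm
  linarith

theorem diamondNorm_smul {r : ℝ} (hr : 0 ≤ r) (v : E (m + 1)) :
    diamondNorm (r • v) = r * diamondNorm v := by
  simp [diamondNorm, norm_smul, abs_mul, abs_of_nonneg hr, mul_add]

theorem diamondNorm_ofTimeSpace (t : ℝ) (x : E m) : diamondNorm (ofTimeSpace t x) = |t| + ‖x‖ :=
  rfl

theorem isFutureTimelike_iff_norm (v : E (m + 1)) : IsFutureTimelike v ↔ ‖space v‖ < v 0 := by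
  rw [isFutureTimelike_iff, ← norm_space_sq, sq_lt_sq, abs_norm]
  constructor
  · rintro ⟨h1, h2⟩
    rwa [abs_of_pos h2] at h1
  · intro h
    exact ⟨h.trans_le (le_abs_self _), (norm_nonneg _).trans_lt h⟩

/-- The two cones are `‖x‖ < 1 - t` and `‖x‖ < 1 + t`, which together say `|t| + ‖x‖ < 1`. -/
theorem mem_diamond {v : E (m + 1)} : v ∈ diamond (m + 1) ↔ diamondNorm v < 1 := by
  have hs : space (timeUnit (m + 1)) = 0 := by
    ext i
    exact if_neg (t := (1 : ℝ)) i.val.succ_ne_zero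
  have ht : timeUnit (m + 1) 0 = 1 := by simp [timeUnit]
  rw [diamond, mem_inter_iff, mem_chronPast, mem_chronFuture, isFutureTimelike_iff_norm,
    isFutureTimelike_iff_norm, map_sub, map_sub, map_neg, hs, PiLp.sub_apply, PiLp.sub_apply,
    PiLp.neg_apply, ht, zero_sub, neg_zero, sub_zero, norm_neg, diamondNorm, ← lt_sub_iff_add_lt,
    abs_lt]
  constructor
  · rintro ⟨h1, h2⟩
    constructor <;> linarith
  · rintro ⟨h1, h2⟩
    constructor <;> linarith

theorem convex_diamond : Convex ℝ (diamond (m + 1)) := by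
  have h : ConvexOn ℝ univ (diamondNorm (m := m)) := ⟨convex_univ, fun x _ y _ a b ha hb _ => by
    simpa [diamondNorm_smul ha, diamondNorm_smul hb] using diamondNorm_add_le (a • x) (b • y)⟩
  have hs : diamond (m + 1) = {v | v ∈ univ ∧ diamondNorm v < 1} := by
    ext v
    simp [mem_diamond]
  rw [hs]
  exact h.convex_lt 1

theorem isGauge_diamond (m : ℕ) : IsGauge (diamond (m + 1)) diamondNorm where
  zero_mem := by simp [mem_diamond, diamondNorm]
  exists_ne_zero := ⟨ofTimeSpace (1 / 2) 0, by
    rw [mem_diamond, diamondNorm_ofTimeSpace]; norm_num, fun h => by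
    have := congrArg (fun v : E (m + 1) => v 0) h
    simp at this⟩
  mapsTo_iff r hr b := by
    constructor
    · intro h
      obtain ⟨σ, hσ, hσb⟩ := exists_abs_add_mul_eq (b 0)
      -- The diamond is open, so `r + diamondNorm b` is only approached: each smaller `c` is reached
      -- by the centre itself or by moving from it along the time axis.
      refine le_of_forall_lt_imp_le_of_dense fun c hc => ?_
      rcases lt_or_ge c (diamondNorm b) with hcb | hcb
      · have h0 : r • (0 : E (m + 1)) + b ∈ diamond (m + 1) :=
          h (by simp [mem_diamond, diamondNorm])
        rw [smul_zero, zero_add, mem_diamond] at h0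
        exact (hcb.trans h0).le
      · have ha : 0 ≤ (c - diamondNorm b) / r := div_nonneg (sub_nonneg.2 hcb) hr.le
        have h1 : r • ofTimeSpace ((c - diamondNorm b) / r * σ) 0 + b ∈ diamond (m + 1) := by
          refine h ?_
          rw [mem_diamond, diamondNorm_ofTimeSpace, abs_mul, hσ, norm_zero, mul_one, add_zero,
            abs_of_nonneg ha, div_lt_one hr]
          linarith
        rw [mem_diamond, diamondNorm] at h1
        simp only [map_add, map_smul, space_ofTimeSpace, smul_zero, zero_add, PiLp.add_apply,
          PiLp.smul_apply, ofTimeSpace_zero, smul_eq_mul] at h1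
        rw [add_comm (r * _), ← mul_assoc, mul_div_cancel₀ _ hr.ne', hσb _ (sub_nonneg.2 hcb)] at h1
        rw [diamondNorm] at h1
        linarith
    · intro h x hx
      rw [mem_diamond] at hx ⊢
      refine (diamondNorm_add_le _ _).trans_lt ?_
      rw [diamondNorm_smul hr.le]
      nlinarith

/-- Over the open diamond of size `ρ` the gap can drop by any amount below `ρ`, but not by `ρ`
itself, hence the non-strict inequality. -/
theorem CDiam_perp_iff (f g : Rect (diamond (m + 1))) : CausallyDisjoint f.image g.image ↔
    f.scale + g.scale ≤ gap (f.center - g.center) := by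
  rw [Rect.causallyDisjoint_iff convex_diamond
    (fun x hx => by simpa [mem_diamond, diamondNorm] using hx)]
  have hρ := add_pos f.scale_pos g.scale_pos
  set ρ := f.scale + g.scale
  set c := f.center - g.center
  constructor
  · intro h
    by_contra! hgap
    obtain ⟨σ, hσ, hσc⟩ := exists_abs_add_mul_eq (c 0)
    -- A time shift of `gap c` brings the gap to zero; the maximum with `0` covers centres that are
    -- already causally related.
    have ha : 0 ≤ max 0 (gap c) / ρ := div_nonneg (le_max_left _ _) hρ.le
    refine (h (ofTimeSpace (max 0 (gap c) / ρ * σ) (0 : E m)) ?_).not_ge ?_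
    · rw [mem_diamond, diamondNorm_ofTimeSpace, abs_mul, hσ, norm_zero, mul_one, add_zero,
        abs_of_nonneg ha, div_lt_one hρ]
      exact max_lt hρ hgap
    · have ht : (c + ρ • ofTimeSpace (max 0 (gap c) / ρ * σ) (0 : E m)) 0 = c 0 + max 0 (gap c) * σ := by
        simp only [PiLp.add_apply, PiLp.smul_apply, ofTimeSpace_zero, smul_eq_mul]
        rw [← mul_assoc, mul_div_cancel₀ _ hρ.ne']
      have hs : space (c + ρ • ofTimeSpace (max 0 (gap c) / ρ * σ) (0 : E m)) = space c := by simp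
      rw [gap, hs, ht, hσc _ (le_max_left _ _)]
      have := le_max_right 0 (gap c)
      rw [gap] at this ⊢
      linarith
  · intro h u hu
    rw [mem_diamond] at hu
    have h1 : gap c - diamondNorm (ρ • u) ≤ gap (c + ρ • u) := gap_sub_le_gap_add c (ρ • u)
    rw [diamondNorm_smul hρ.le] at h1
    nlinarith

end DiamondImages

theorem CDiam_homotopyEquivalent_Disc (m : ℕ) :
    (CDiam (m + 2)).prefact.HomotopyEquivalent (Disc (m + 1)).prefact := by
  refine Relation.EqvGen.rel _ _ (exists_isEquivalence_disc (isGauge_diamond (m + 1))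
    (fun b => le_add_of_nonneg_left (abs_nonneg _)) (fun x => ?_) (fun c hc b => ?_)
    (P := fun ρ d => ρ ≤ d) CDiam_perp_iff
    (fun ρ d _ h => h) (fun ρ ρ' d d' hρ hd h => (hρ.trans h).trans hd) (fun ρ d hρ h => ?_))
  · simp [diamondNorm_ofTimeSpace]
  · rw [diamondNorm_ofTimeSpace, abs_mul, abs_of_nonneg hc.1]
    exact add_le_add_left (mul_le_of_le_one_left (abs_nonneg _) hc.2) _
  · linarith

end CausalOperad

end

theorem mainTheorem2 (n : ℕ) (hn : 2 ≤ n) :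
    (CausalOperad.CD n).prefact.HomotopyEquivalent (CausalOperad.CDiam n).prefact ∧
    (CausalOperad.CDiam n).prefact.HomotopyEquivalent (CausalOperad.Disc (n - 1)).prefact ∧
    (CausalOperad.CD n).prefact.HomotopyEquivalent (CausalOperad.Disc (n - 1)).prefact := by
  -- With `n = m + 2` the space dimension is `m + 1 > 0`, so scales of discs are determined; `m + 2
  -- - 1` is `m + 1` by definition.
  obtain ⟨m, rfl⟩ := Nat.exists_eq_add_of_le' hn
  have h1 := CausalOperad.CD_homotopyEquivalent_Disc m
  have h2 := CausalOperad.CDiam_homotopyEquivalent_Disc m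
  exact ⟨h1.trans _ _ _ (h2.symm _ _), h2, h1⟩
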